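/- Let $k$ be an algebraically closed field of characteristic different from $2$ and $3$, and let $W=\langle t_0,t_1\rangle$ be the space of linear forms over $k$. The group $\mathrm{PGL}_2=\mathrm{PGL}_2(k)$ acts on the Grassmannian $\mathrm{Gr}(2,4)=\mathrm{Gr}(2,\mathrm{Sym}^3W)$ of pencils of binary cubics, the class of a matrix $A$ acting through $t_j\mapsto\sum_i A_{ij}t_i$. A point $p$ of $\mathrm{Gr}(2,4)$ is called stable if it is stable in the sense of geometric invariant theory for the Plücker embedding $\mathrm{Gr}(2,4)\subset\mathbb{P}(\Lambda^2\mathrm{Sym}^3W)$: its stabilizer in $\mathrm{PGL}_2$ is finite, and there is an $\mathrm{SL}_2$-invariant form $F$ of positive degree in the Plücker coordinates with $F(p)\neq 0$ such that all orbits in $\{F\ne 0\}\subset\mathrm{Gr}(2,4)$ are closed in $\{F\neq 0\}$. For $\rho\in k$ put $p_\rho=\langle t_0^3+\rho t_0t_1^2,\ \rho t_0^2t_1+t_1^3\rangle$, and put $p_\infty=\langle t_0t_1^2,\ t_0^2t_1\rangle$. In $\mathrm{PGL}_2$ let $$D_4=\left\langle\begin{pmatrix}1&0\\0&-1\end{pmatrix},\begin{pmatrix}0&-1\\1&0\end{pmatrix}\right\rangle,\qquad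 S_4:=N_{\mathrm{PGL}_2}(D_4).$$ The group $S_4$ is isomorphic to the symmetric group on four letters, and for each primitive fourth root of unity $\omega\in k$ it is generated by $D_4$ together with the classes of $\begin{pmatrix}\omega&-1\\\omega&1\end{pmatrix}$ and $\begin{pmatrix}-1&1\\1&1\end{pmatrix}$. Moreover: 1. If $\rho\in k\cup\{\infty\}$ and $p_\rho$ is stable, then $N_{\mathrm{PGL}_2}(\mathrm{Stab}_{\mathrm{PGL}_2}(p_\rho))=S_4$. 2. If $\rho\in k\cup\{\infty\}$ and $p_\rho$ is stable, then $\rho\in k$, $\rho\neq\pm1$, and $$S_4\cdot p_\rho=\left\{p_\rho,\ p_{-\rho},\ p_{\frac{\rho+3}{\rho-1}},\ p_{-\frac{\rho+3}{\rho-1}},\ p_{\frac{\rho-3}{\rho+1}},\ p_{-\frac{\rho-3}{\rho+1}}\right\}.$$ 3. If $\rho,\rho'\in k\cup\{\infty\}$ and $p_\rho,p_{\rho'}$ are stable, then $p_\rho$ and $p_{\rho'}$ lie in the same $\mathrm{PGL}_2$-orbit if and only if $\sigma\cdot p_\rho=p_{\rho'}$ for some $\sigma\in S_4$. -/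

import Mathlib

open MvPolynomial

/-- The group `PGL₂(k)`, the quotient of `GL₂(k)` by its center. -/
abbrev PGL2 (k : Type*) [Field k] : Type _ := Matrix.ProjGenLinGroup (Fin 2) k

section Action

variable {k : Type*} [Field k]

/-- The action of a `2 × 2` matrix `A` on `Sym W = k[t₀, t₁]`, where `A` acts on
`W = ⟨t₀, t₁⟩` in the basis `t₀, t₁`, that is `t_j ↦ ∑ i, A i j • t_i`. -/
noncomputable def formAct (A : Matrix (Fin 2) (Fin 2) k) :
    MvPolynomial (Fin 2) k →ₐ[k] MvPolynomial (Fin 2) k :=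
  aeval (fun j => ∑ i, C (A i j) * X i)

theorem formAct_X (A : Matrix (Fin 2) (Fin 2) k) (j : Fin 2) :
    formAct A (X j) = ∑ i, C (A i j) * X i := by
  simp [formAct]

theorem formAct_one : formAct (1 : Matrix (Fin 2) (Fin 2) k) = AlgHom.id k _ := by
  refine MvPolynomial.algHom_ext fun j => ?_
  fin_cases j <;> simp [formAct_X, Matrix.one_apply]

theorem formAct_mul (A B : Matrix (Fin 2) (Fin 2) k) :
    formAct (A * B) = (formAct A).comp (formAct B) := by
  refine MvPolynomial.algHom_ext fun j => ?_
  simp only [AlgHom.comp_apply, formAct_X, map_mul, Fin.sum_univ_two, Matrix.mul_apply,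
    map_add, algHom_C, algebraMap_eq]
  ring

theorem formAct_homogeneous (A : Matrix (Fin 2) (Fin 2) k) {n : ℕ} {f : MvPolynomial (Fin 2) k}
    (hf : f.IsHomogeneous n) : (formAct A f).IsHomogeneous n := by
  have h : (formAct A f).IsHomogeneous (1 * n) :=
    hf.aeval _ fun j => IsHomogeneous.sum _ _ _ fun i _ => isHomogeneous_C_mul_X _ i
  rwa [one_mul] at h

theorem formAct_injective (A : GL (Fin 2) k) :
    Function.Injective (formAct (A : Matrix (Fin 2) (Fin 2) k)) := by
  have h : Function.LeftInverse (formAct ((A⁻¹ : GL (Fin 2) k) : Matrix (Fin 2) (Fin 2) k))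
      (formAct (A : Matrix (Fin 2) (Fin 2) k)) := by
    intro f
    rw [← AlgHom.comp_apply, ← formAct_mul, ← Units.val_mul, inv_mul_cancel, Units.val_one,
      formAct_one, AlgHom.id_apply]
  exact h.injective

/-- A scalar matrix `u` multiplies forms of degree `n` by `u ^ n`. -/
theorem formAct_scalar (u : k) {n : ℕ} {f : MvPolynomial (Fin 2) k} (hf : f.IsHomogeneous n) :
    formAct (Matrix.scalar (Fin 2) u) f = u ^ n • f := by
  have h : formAct (Matrix.scalar (Fin 2) u) f = aeval (fun j => u • X j) f := by
    unfold formAct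
    congr 2
    funext j
    fin_cases j <;> simp [smul_eq_C_mul]
  rw [h]
  conv_rhs => rw [f.as_sum]
  conv_lhs => rw [f.as_sum]
  rw [map_sum, Finset.smul_sum]
  refine Finset.sum_congr rfl fun m hm => ?_
  have hdeg : m 0 + m 1 = n := by
    have h1 := hf (mem_support_iff.mp hm)
    rw [← h1, Finsupp.weight_apply, Finsupp.sum_fintype _ _ (by simp)]
    simp
  rw [aeval_monomial, monomial_eq, Finsupp.prod_fintype _ _ (by simp),
    Finsupp.prod_fintype _ _ (by simp), ← hdeg]
  simp only [smul_eq_C_mul, Fin.prod_univ_two, algebraMap_eq, pow_add, mul_pow, C_mul, C_pow]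
  ring

end Action

/-- The Grassmannian `Gr(2, Sym³ W) = Gr(2, 4)` of pencils of binary cubics: the two-dimensional
subspaces of the space of binary cubic forms in `t₀ = X 0`, `t₁ = X 1`. -/
@[ext]
structure Pencil (k : Type*) [Field k] where
  carrier : Submodule k (MvPolynomial (Fin 2) k)
  le_cubic : carrier ≤ homogeneousSubmodule (Fin 2) k 3
  finrank_eq : Module.finrank k carrier = 2

namespace Pencil

section Group

variable {k : Type*} [Field k]

noncomputable instance : MulAction (GL (Fin 2) k) (Pencil k) where
  smul A p :=
    { carrier := p.carrier.map (formAct (A : Matrix (Fin 2) (Fin 2) k)).toLinearMap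
      le_cubic := by
        rintro _ ⟨f, hf, rfl⟩
        exact formAct_homogeneous _ (p.le_cubic hf)
      finrank_eq := by
        exact (Submodule.equivMapOfInjective
          (formAct (A : Matrix (Fin 2) (Fin 2) k)).toLinearMap (formAct_injective A)
            p.carrier).finrank_eq.symm.trans p.finrank_eq }
  one_smul p := by
    refine Pencil.ext ?_
    change p.carrier.map (formAct ((1 : GL (Fin 2) k) : Matrix (Fin 2) (Fin 2) k)).toLinearMap = _
    rw [Units.val_one, formAct_one]
    exact Submodule.map_id _
  mul_smul A B p := by
    refine Pencil.ext ?_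
    change p.carrier.map (formAct ((A * B : GL (Fin 2) k) : Matrix (Fin 2) (Fin 2) k)).toLinearMap
      = (p.carrier.map (formAct (B : Matrix (Fin 2) (Fin 2) k)).toLinearMap).map
        (formAct (A : Matrix (Fin 2) (Fin 2) k)).toLinearMap
    rw [Units.val_mul, formAct_mul, ← Submodule.map_comp]
    rfl

theorem GL_smul_carrier (A : GL (Fin 2) k) (p : Pencil k) :
    (A • p).carrier = p.carrier.map (formAct (A : Matrix (Fin 2) (Fin 2) k)).toLinearMap :=
  rfl

theorem scalar_smul (u : kˣ) (p : Pencil k) :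
    (Matrix.GeneralLinearGroup.scalar (Fin 2) u : GL (Fin 2) k) • p = p := by
  have key : ∀ f ∈ p.carrier,
      formAct ((Matrix.GeneralLinearGroup.scalar (Fin 2) u : GL (Fin 2) k) :
        Matrix (Fin 2) (Fin 2) k) f = (u : k) ^ 3 • f := fun f hf =>
    formAct_scalar (u : k) (p.le_cubic hf)
  refine Pencil.ext (le_antisymm ?_ ?_)
  · rintro _ ⟨f, hf, rfl⟩
    change formAct _ f ∈ _
    rw [key f hf]
    exact p.carrier.smul_mem _ hf
  · intro f hf
    refine ⟨((u : k) ^ 3)⁻¹ • f, p.carrier.smul_mem _ hf, ?_⟩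
    change formAct _ _ = f
    rw [map_smul, key f hf, smul_smul, inv_mul_cancel₀ (pow_ne_zero _ u.ne_zero), one_smul]

/-- The homomorphism from `PGL₂(k)` to the permutations of `Gr(2, 4)` through which
`GL₂(k)` acts. -/
noncomputable def pglHom (k : Type*) [Field k] : PGL2 k →* Equiv.Perm (Pencil k) :=
  QuotientGroup.lift (Subgroup.center (GL (Fin 2) k))
    (MulAction.toPermHom (GL (Fin 2) k) (Pencil k)) (by
      intro A hA
      rw [Matrix.GeneralLinearGroup.center_eq_range_scalar] at hA
      obtain ⟨u, rfl⟩ := hA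
      exact Equiv.ext fun p => scalar_smul u p)

noncomputable instance : MulAction (PGL2 k) (Pencil k) :=
  MulAction.compHom (Pencil k) (pglHom k)

theorem mk_smul (A : GL (Fin 2) k) (p : Pencil k) :
    (Matrix.ProjGenLinGroup.mk A : PGL2 k) • p = A • p :=
  rfl

end Group

section Stability

variable {k : Type*} [Field k]

/-- The coefficient of `t₀^(3-i) t₁^i`. -/
noncomputable def cubicCoeff (f : MvPolynomial (Fin 2) k) (i : Fin 4) : k :=
  coeff (Finsupp.single 0 (3 - (i : ℕ)) + Finsupp.single 1 (i : ℕ)) f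

/-- The Plücker coordinates `p_{ij} = a_i b_j - a_j b_i` of a pair of binary cubics. -/
noncomputable def plucker (f g : MvPolynomial (Fin 2) k) : Fin 4 × Fin 4 → k :=
  fun ij => cubicCoeff f ij.1 * cubicCoeff g ij.2 - cubicCoeff f ij.2 * cubicCoeff g ij.1

/-- The homogeneous polynomial `F` in the Plücker coordinates vanishes at the point `p`. -/
def VanishesAt (F : MvPolynomial (Fin 4 × Fin 4) k) (p : Pencil k) : Prop :=
  ∀ f ∈ p.carrier, ∀ g ∈ p.carrier, eval (plucker f g) F = 0

/-- `F` is `SL₂(k)`-invariant as a function on the affine cone over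
`Gr(2, Sym³ W) ⊂ ℙ(Λ² Sym³ W)`. -/
def IsInvariant (F : MvPolynomial (Fin 4 × Fin 4) k) : Prop :=
  ∀ A : Matrix.SpecialLinearGroup (Fin 2) k, ∀ f g : MvPolynomial (Fin 2) k,
    f.IsHomogeneous 3 → g.IsHomogeneous 3 →
      eval (plucker (formAct A.1 f) (formAct A.1 g)) F = eval (plucker f g) F

/-- `S` is a Zariski closed subset of the subspace `U` of `Gr(2, 4)`. -/
def IsZariskiClosedIn (U S : Set (Pencil k)) : Prop :=
  ∃ T : Set (MvPolynomial (Fin 4 × Fin 4) k), (∀ F ∈ T, ∃ d : ℕ, F.IsHomogeneous d) ∧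
    S = {q | q ∈ U ∧ ∀ F ∈ T, VanishesAt F q}

/-- Stability in the sense of geometric invariant theory, for the Plücker linearization
(for `k` algebraically closed): the stabilizer of `p` is finite, and some invariant form `F` of
positive degree does not vanish at `p` and is such that all orbits in the open set
`Gr(2, 4)_F = {F ≠ 0}` are closed in it. -/
def IsStable (p : Pencil k) : Prop :=
  Finite (MulAction.stabilizer (PGL2 k) p) ∧
    ∃ (d : ℕ) (F : MvPolynomial (Fin 4 × Fin 4) k), 0 < d ∧ F.IsHomogeneous d ∧ IsInvariant F ∧
      ¬ VanishesAt F p ∧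
      ∀ q : Pencil k, ¬ VanishesAt F q →
        IsZariskiClosedIn {r | ¬ VanishesAt F r} (MulAction.orbit (PGL2 k) q)

end Stability

section Wall

variable {k : Type*} [Field k]

theorem finrank_span_pair_eq {f g : MvPolynomial (Fin 2) k} (h : LinearIndependent k ![f, g]) :
    Module.finrank k (Submodule.span k {f, g}) = 2 := by
  have h1 := finrank_span_eq_card h
  rw [Matrix.range_cons_cons_empty] at h1
  simpa using h1

/-- The pencil spanned by two linearly independent binary cubics. -/
noncomputable def ofPair (f g : MvPolynomial (Fin 2) k) (hf : f.IsHomogeneous 3) (hg : g.IsHomogeneous 3)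
    (h : LinearIndependent k ![f, g]) : Pencil k where
  carrier := Submodule.span k {f, g}
  le_cubic := by
    rw [Submodule.span_le]
    rintro x (rfl | rfl)
    · exact hf
    · exact hg
  finrank_eq := finrank_span_pair_eq h

theorem monomial_homogeneous (a b : ℕ) (c : k) (hab : a + b = 3) :
    (C c * (X 0 ^ a * X 1 ^ b) : MvPolynomial (Fin 2) k).IsHomogeneous 3 := by
  have h := (isHomogeneous_X_pow (R := k) (0 : Fin 2) a).mul
    (isHomogeneous_X_pow (R := k) (1 : Fin 2) b)
  rw [hab] at h
  exact h.C_mul c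

theorem coeff_X_pow_mul (a b c d : ℕ) :
    lcoeff k (Finsupp.single (0 : Fin 2) c + Finsupp.single 1 d)
      (X 0 ^ a * X 1 ^ b : MvPolynomial (Fin 2) k) = if a = c ∧ b = d then 1 else 0 := by
  have h : (X 0 ^ a * X 1 ^ b : MvPolynomial (Fin 2) k)
      = monomial (Finsupp.single (0 : Fin 2) a + Finsupp.single 1 b) 1 := by
    simp [X_pow_eq_monomial, monomial_mul]
  rw [h, lcoeff_apply, coeff_monomial]
  refine if_congr ⟨fun e => ?_, ?_⟩ rfl rfl
  · exact ⟨by simpa using DFunLike.congr_fun e 0, by simpa using DFunLike.congr_fun e 1⟩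
  · rintro ⟨rfl, rfl⟩
    rfl

theorem linearIndependent_of_eval {f g : MvPolynomial (Fin 2) k}
    (φ ψ : (MvPolynomial (Fin 2) k) →ₗ[k] k)
    (h1 : φ f = 1) (h2 : φ g = 0) (h3 : ψ f = 0) (h4 : ψ g = 1) :
    LinearIndependent k ![f, g] := by
  rw [LinearIndependent.pair_iff]
  intro s t hst
  have e1 := congrArg φ hst
  have e2 := congrArg ψ hst
  simp only [map_add, map_smul, map_zero, h1, h2, h3, h4, smul_eq_mul, mul_one, mul_zero,
    add_zero, zero_add] at e1 e2
  exact ⟨e1, e2⟩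

/-- `p_ρ = ⟨t₀³ + ρ t₀ t₁², ρ t₀² t₁ + t₁³⟩` for `ρ ∈ k`. -/
noncomputable def wallFinite (ρ : k) : Pencil k :=
  ofPair (X 0 ^ 3 + C ρ * (X 0 * X 1 ^ 2)) (C ρ * (X 0 ^ 2 * X 1) + X 1 ^ 3)
    ((isHomogeneous_X_pow _ 3).add (by simpa using monomial_homogeneous 1 2 ρ rfl))
    (IsHomogeneous.add (by simpa using monomial_homogeneous 2 1 ρ rfl) (isHomogeneous_X_pow _ 3))
    (linearIndependent_of_eval (aeval ![(1 : k), 0]).toLinearMap (aeval ![(0 : k), 1]).toLinearMap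
      (by simp) (by simp) (by simp) (by simp))

/-- `p_∞ = ⟨t₀ t₁², t₀² t₁⟩`. -/
noncomputable def wallInfty : Pencil k :=
  ofPair (X 0 * X 1 ^ 2) (X 0 ^ 2 * X 1)
    (by simpa using monomial_homogeneous 1 2 (1 : k) rfl)
    (by simpa using monomial_homogeneous 2 1 (1 : k) rfl)
    (linearIndependent_of_eval
      (lcoeff k (Finsupp.single 0 1 + Finsupp.single 1 2))
      (lcoeff k (Finsupp.single 0 2 + Finsupp.single 1 1))
      (by simpa using coeff_X_pow_mul (k := k) 1 2 1 2)
      (by simpa using coeff_X_pow_mul (k := k) 2 1 1 2)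
      (by simpa using coeff_X_pow_mul (k := k) 1 2 2 1)
      (by simpa using coeff_X_pow_mul (k := k) 2 1 2 1))

/-- The Wall representative `p_ρ` for `ρ ∈ k ∪ {∞}`. -/
noncomputable def wall : OnePoint k → Pencil k
  | none => wallInfty
  | some ρ => wallFinite ρ

end Wall

end Pencil

section Subgroups

variable {k : Type*} [Field k]

/-- The subgroup of `PGL₂(k)` generated by the classes of the invertible matrices in `S`. -/
def pglClosure (S : Set (Matrix (Fin 2) (Fin 2) k)) : Subgroup (PGL2 k) :=
  Subgroup.closure {x | ∃ A : GL (Fin 2) k,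
    (A : Matrix (Fin 2) (Fin 2) k) ∈ S ∧ Matrix.ProjGenLinGroup.mk A = x}

/-- The distinguished dihedral subgroup `D₄` of order `4` in `PGL₂(k)`. -/
def dihedralD4 (k : Type*) [Field k] : Subgroup (PGL2 k) :=
  pglClosure {!![1, 0; 0, -1], !![0, -1; 1, 0]}

/-- The distinguished subgroup `S₄ = N(D₄)` of `PGL₂(k)`. -/
def octahedralS4 (k : Type*) [Field k] : Subgroup (PGL2 k) :=
  Subgroup.normalizer (dihedralD4 k : Set (PGL2 k))

end Subgroups

/-!
The argument rests on one computation. Call `ρ` nondegenerate if `ρ ∈ k` and `ρ` is none of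
`0, ±1, ±3`. A traceless matrix stabilizing `p_ρ` satisfies four cubic equations in its entries,
and for nondegenerate `ρ` their only invertible solutions represent the three involutions of the
four-group `V = D₄` (`Pencil.involution_mem_closure`). Since `V` consists of involutions fixing
every `p_ρ`, any `x` with `x • p_ρ = p_ρ'` and `ρ'` nondegenerate conjugates `V` into involutions
fixing `p_ρ'`, so `x` normalizes `V` (`Pencil.mem_octahedralS4_of_smul_eq`). Thus two such pencils
are conjugate under `PGL₂` only through `S₄ = N(V)`, and both the stabilizer of `p_ρ` and the
normalizer of that stabilizer lie in `S₄`.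

Stable pencils `p_ρ` are nondegenerate: `p_0` and `p_∞` are fixed by the diagonal torus, and
`p_{±3}`, `p_{±1}` are conjugate to them (`Pencil.ne_of_finite_stabilizer`).

The structure of `N(V)` is group theory. The element `τ` of order three permutes the involutions of
`V` cyclically, `s` swaps two of them, and `V` is its own centralizer, so every element of `N(V)` is
of the form `τ ^ i * s ^ j * d` with `d ∈ V`. This gives the generators. Moreover the normalizer of
`⟨τ⟩` in `N(V)` is a complement of `V` of order six, and `N(V)` acts faithfully on its four cosets
(`OctahedralFrame.nonempty_normalizer_mulEquiv_perm`).

The normal form also yields the six members of the orbit `S₄ • p_ρ`. Comparing them with `p_ρ`, a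
stabilizing element outside `V` exists only if `ρ ^ 2 = -3`, and then the orbit is
`{p_ρ, p_{-ρ}}` with both members having the same stabilizer; hence `S₄` normalizes the stabilizer
in all cases (`Pencil.smul_smul_eq_of_mem_octahedralS4`).
-/

/-! ### Normalizers of self-centralizing four-groups -/

section OctahedralFrame

variable {G : Type*} [Group G]

/-- Elements of a group `G` that behave like generators of the rotation group of the cube:
`h` and `w` generate a Klein four-group that is its own centralizer, `τ` is an element of order
three permuting `h`, `h * w`, `w` cyclically, and `s` is an involution that inverts `τ`, commutes
with `w` and swaps `h` with `h * w`. -/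
structure OctahedralFrame (h w τ s : G) : Prop where
  h_sq : h * h = 1
  w_sq : w * w = 1
  comm : w * h = h * w
  h_ne : h ≠ 1
  w_ne : w ≠ 1
  h_ne_w : h ≠ w
  conj_τ_h : τ * h * τ⁻¹ = h * w
  conj_τ_w : τ * w * τ⁻¹ = h
  conj_s_h : s * h * s⁻¹ = h * w
  conj_s_w : s * w * s⁻¹ = w
  τ_cube : τ ^ 3 = 1
  s_sq : s * s = 1
  conj_s_τ : s * τ * s⁻¹ = τ⁻¹
  centralizer_le : ∀ g, g * h * g⁻¹ = h → g * w * g⁻¹ = w → g ∈ Subgroup.closure {h, w}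

theorem conj_mul_left (a b x : G) : (a * b) * x * (a * b)⁻¹ = a * (b * x * b⁻¹) * a⁻¹ := by
  group

theorem conj_mul_right (a x y : G) : a * (x * y) * a⁻¹ = (a * x * a⁻¹) * (a * y * a⁻¹) := by
  group

/-- A group with a normal subgroup `V` of order four that contains its own centralizer, and a
complement `H` of `V` of order divisible by six, is the symmetric group on four letters: it acts
faithfully on the four cosets of `H`. -/
theorem nonempty_mulEquiv_perm_of_isComplement' (V H : Subgroup G) [V.Normal]
    (hVH : V.IsComplement' H) (hV : Nat.card V = 4) (hcent : Subgroup.centralizer (V : Set G) ≤ V)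
    (hH : 6 ∣ Nat.card H) : Nonempty (G ≃* Equiv.Perm (Fin 4)) := by
  have hindex : Nat.card (G ⧸ H) = 4 := by
    rw [← hV, ← hVH.index_eq_card]; rfl
  have hfin : Finite (G ⧸ H) := Nat.finite_of_card_ne_zero (by omega)
  -- The kernel of the action meets `V` trivially, so it centralizes `V` and lies in `V`.
  have hcore : H.normalCore = ⊥ := by
    have hdisj : Disjoint H.normalCore V := hVH.disjoint.symm.mono_left H.normalCore_le
    have hle : H.normalCore ≤ V := fun x hx => hcent fun y hy =>
      (Subgroup.commute_of_normal_of_disjoint _ _ inferInstance inferInstance hdisj x y hx hy).symm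
    exact hdisj.eq_bot_of_le hle
  have hinj : Function.Injective (MulAction.toPermHom G (G ⧸ H)) := by
    rw [← MonoidHom.ker_eq_bot_iff, ← Subgroup.normalCore_eq_ker, hcore]
  have hGfin : Finite G := Finite.of_injective _ hinj
  have hcard : Nat.card (Equiv.Perm (G ⧸ H)) ≤ Nat.card G := by
    rw [Nat.card_perm, hindex, ← hVH.card_mul_card, hV]
    have := Nat.le_of_dvd Nat.card_pos hH
    simp only [Nat.factorial]
    omega
  exact ⟨(MulEquiv.ofBijective _ (hinj.bijective_of_nat_card_le hcard)).trans
    (Finite.equivFinOfCardEq hindex).permCongrHom⟩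

namespace OctahedralFrame

variable {h w τ s : G}

theorem mem_closure_iff (F : OctahedralFrame h w τ s) {x : G} :
    x ∈ Subgroup.closure {h, w} ↔ x = 1 ∨ x = h ∨ x = w ∨ x = h * w := by
  have hh : h ∈ Subgroup.closure {h, w} := Subgroup.subset_closure (by simp)
  have hw : w ∈ Subgroup.closure {h, w} := Subgroup.subset_closure (by simp)
  have e1 : ∀ x, h * (h * x) = x := fun x => by rw [← mul_assoc, F.h_sq, one_mul]
  have e3 : ∀ x, w * (h * x) = h * (w * x) := fun x => by
    rw [← mul_assoc, F.comm, mul_assoc]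
  refine ⟨fun hx => ?_, ?_⟩
  · induction hx using Subgroup.closure_induction with
    | mem x hx => rcases hx with rfl | rfl <;> simp
    | one => simp
    | mul x y _ _ hx hy =>
      rcases hx with rfl | rfl | rfl | rfl <;> rcases hy with rfl | rfl | rfl | rfl <;>
        simp [mul_assoc, F.h_sq, F.w_sq, F.comm, e1, e3]
    | inv x _ hx =>
      have : x⁻¹ = x := inv_eq_of_mul_eq_one_left (by
        rcases hx with rfl | rfl | rfl | rfl <;>
          simp [mul_assoc, F.h_sq, F.w_sq, e3])
      rwa [this]
  · rintro (rfl | rfl | rfl | rfl)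
    exacts [one_mem _, hh, hw, mul_mem hh hw]

theorem h_ne_mul (F : OctahedralFrame h w τ s) : h ≠ h * w := fun e => F.w_ne (by simpa using e)

theorem w_ne_mul (F : OctahedralFrame h w τ s) : w ≠ h * w := fun e => F.h_ne (by simpa using e)

theorem finite_closure (F : OctahedralFrame h w τ s) :
    ((Subgroup.closure {h, w} : Subgroup G) : Set G).Finite := by
  refine ({1, h, w, h * w} : Set G).toFinite.subset fun x hx => ?_
  simpa using F.mem_closure_iff.mp hx

theorem card_closure (F : OctahedralFrame h w τ s) : Nat.card (Subgroup.closure {h, w}) = 4 := by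
  classical
  have hset : ((Subgroup.closure {h, w} : Subgroup G) : Set G)
      = (({1, h, w, h * w} : Finset G) : Set G) := by
    ext x
    simpa using F.mem_closure_iff
  have hmul : h * w ≠ 1 := fun e => F.h_ne_w (by
    rw [← mul_left_inj w, e, F.w_sq])
  rw [← SetLike.coe_sort_coe, hset, Nat.card_coe_set_eq, Set.ncard_coe_finset]
  rw [Finset.card_insert_of_notMem, Finset.card_insert_of_notMem, Finset.card_insert_of_notMem,
    Finset.card_singleton]
  · simpa using F.w_ne_mul
  · simpa using ⟨F.h_ne_w, F.w_ne⟩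
  · simp [F.h_ne.symm, F.w_ne.symm, hmul.symm]

theorem conj_τ_mul (F : OctahedralFrame h w τ s) : τ * (h * w) * τ⁻¹ = w := by
  rw [conj_mul_right, F.conj_τ_h, F.conj_τ_w, mul_assoc, F.comm, ← mul_assoc, F.h_sq, one_mul]

theorem conj_s_mul (F : OctahedralFrame h w τ s) : s * (h * w) * s⁻¹ = h := by
  rw [conj_mul_right, F.conj_s_h, F.conj_s_w, mul_assoc, F.w_sq, mul_one]

/-- Since the Klein four-group is finite, mapping its generators into it is enough to
normalize it. -/
theorem mem_normalizer_of (F : OctahedralFrame h w τ s) {g : G}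
    (hh : g * h * g⁻¹ ∈ Subgroup.closure {h, w}) (hw : g * w * g⁻¹ ∈ Subgroup.closure {h, w}) :
    g ∈ Subgroup.normalizer (Subgroup.closure {h, w} : Set G) := by
  have := F.finite_closure.to_subtype
  refine Subgroup.mem_normalizer_fintype fun n hn => ?_
  rcases F.mem_closure_iff.mp hn with rfl | rfl | rfl | rfl
  · simp
  · exact hh
  · exact hw
  · rw [conj_mul_right]
    exact mul_mem hh hw

theorem τ_mem_normalizer (F : OctahedralFrame h w τ s) :
    τ ∈ Subgroup.normalizer (Subgroup.closure {h, w} : Set G) :=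
  F.mem_normalizer_of (by simp [F.mem_closure_iff, F.conj_τ_h])
    (by simp [F.mem_closure_iff, F.conj_τ_w])

theorem s_mem_normalizer (F : OctahedralFrame h w τ s) :
    s ∈ Subgroup.normalizer (Subgroup.closure {h, w} : Set G) :=
  F.mem_normalizer_of (by simp [F.mem_closure_iff, F.conj_s_h])
    (by simp [F.mem_closure_iff, F.conj_s_w])

/-- Elements of the normalizer fixing `w` lie in the cosets of `1` and `s`. -/
theorem exists_eq_s_pow_mul (F : OctahedralFrame h w τ s) {g : G}
    (hg : g ∈ Subgroup.normalizer (Subgroup.closure {h, w} : Set G)) (hw : g * w * g⁻¹ = w) :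
    ∃ j < 2, ∃ d ∈ Subgroup.closure {h, w}, g = s ^ j * d := by
  have hmem := (Subgroup.mem_normalizer_iff.mp hg h).mp (Subgroup.subset_closure (by simp))
  rcases F.mem_closure_iff.mp hmem with e | e | e | e
  · exact absurd (conj_eq_one_iff.mp e) F.h_ne
  · exact ⟨0, by omega, g, F.centralizer_le g e hw, by simp⟩
  · exact absurd (conj_injective (e.trans hw.symm)) F.h_ne_w
  · refine ⟨1, by omega, s * g, F.centralizer_le _ ?_ ?_, ?_⟩
    · rw [conj_mul_left, e, F.conj_s_mul]
    · rw [conj_mul_left, hw, F.conj_s_w]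
    · rw [pow_one, ← mul_assoc, F.s_sq, one_mul]

/-- The normalizer of the Klein four-group permutes its three involutions, and `τ` and `s` realize
all six permutations; hence every element of the normalizer has this normal form. -/
theorem exists_eq_τ_pow_mul_s_pow_mul (F : OctahedralFrame h w τ s) {g : G}
    (hg : g ∈ Subgroup.normalizer (Subgroup.closure {h, w} : Set G)) :
    ∃ i < 3, ∃ j < 2, ∃ d ∈ Subgroup.closure {h, w}, g = τ ^ i * s ^ j * d := by
  have hmem := (Subgroup.mem_normalizer_iff.mp hg w).mp (Subgroup.subset_closure (by simp))
  have hτ := F.τ_mem_normalizer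
  have h3 := F.τ_cube
  rcases F.mem_closure_iff.mp hmem with e | e | e | e
  · exact absurd (conj_eq_one_iff.mp e) F.w_ne
  · obtain ⟨j, hj, d, hd, e'⟩ := F.exists_eq_s_pow_mul (g := τ ^ 2 * g)
      (mul_mem (pow_mem hτ 2) hg) (by
        rw [conj_mul_left, e, pow_two, conj_mul_left, F.conj_τ_h, F.conj_τ_mul])
    refine ⟨1, by omega, j, hj, d, hd, ?_⟩
    rw [mul_assoc, ← e', ← mul_assoc, ← pow_add, h3, one_mul]
  · obtain ⟨j, hj, d, hd, e'⟩ := F.exists_eq_s_pow_mul hg e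
    exact ⟨0, by omega, j, hj, d, hd, by rw [e', pow_zero, one_mul]⟩
  · obtain ⟨j, hj, d, hd, e'⟩ := F.exists_eq_s_pow_mul (g := τ * g) (mul_mem hτ hg) (by
      rw [conj_mul_left, e, F.conj_τ_mul])
    refine ⟨2, by omega, j, hj, d, hd, ?_⟩
    rw [mul_assoc, ← e', ← mul_assoc, ← pow_succ, h3, one_mul]

theorem normalizer_eq_closure (F : OctahedralFrame h w τ s) :
    Subgroup.normalizer (Subgroup.closure {h, w} : Set G) = Subgroup.closure {τ, s, h, w} := by
  refine le_antisymm (fun g hg => ?_) ?_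
  · obtain ⟨i, -, j, -, d, hd, rfl⟩ := F.exists_eq_τ_pow_mul_s_pow_mul hg
    refine mul_mem (mul_mem (pow_mem ?_ i) (pow_mem ?_ j)) (Subgroup.closure_mono ?_ hd)
    · exact Subgroup.subset_closure (by simp)
    · exact Subgroup.subset_closure (by simp)
    · exact fun x hx => Or.inr (Or.inr hx)
  · rw [Subgroup.closure_le]
    rintro x (rfl | rfl | rfl | rfl)
    · exact F.τ_mem_normalizer
    · exact F.s_mem_normalizer
    · exact Subgroup.le_normalizer (Subgroup.subset_closure (by simp))
    · exact Subgroup.le_normalizer (Subgroup.subset_closure (by simp))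

theorem τ_ne_one (F : OctahedralFrame h w τ s) : τ ≠ 1 := by
  rintro rfl
  exact F.h_ne_mul (by simpa using F.conj_τ_h)

theorem s_ne_one (F : OctahedralFrame h w τ s) : s ≠ 1 := by
  rintro rfl
  exact F.h_ne_mul (by simpa using F.conj_s_h)

/-- The Klein four-group meets the normalizer of `⟨τ⟩` trivially: a common element commutes with
`τ`, which permutes the three involutions without fixed points. -/
theorem eq_one_of_mem_normalizer_zpowers (F : OctahedralFrame h w τ s) {d : G}
    (hd : d ∈ Subgroup.closure {h, w})
    (hd' : d ∈ Subgroup.normalizer (Subgroup.zpowers τ : Set G)) : d = 1 := by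
  have hcomm : τ * d * τ⁻¹ = d := by
    -- The commutator of `τ` and `d` lies in `⟨τ⟩` and in the four-group, so its order divides
    -- both `3` and `4`.
    have h1 : τ * d * τ⁻¹ * d⁻¹ ∈ Subgroup.closure {h, w} :=
      mul_mem ((Subgroup.mem_normalizer_iff.mp F.τ_mem_normalizer d).mp hd) (inv_mem hd)
    have h2 : τ * d * τ⁻¹ * d⁻¹ ∈ Subgroup.zpowers τ := by
      have := (Subgroup.mem_normalizer_iff.mp hd' τ⁻¹).mp
        (inv_mem (Subgroup.mem_zpowers τ))
      have := mul_mem (Subgroup.mem_zpowers τ) this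
      simpa only [mul_assoc] using this
    have h3 : (τ * d * τ⁻¹ * d⁻¹) ^ 3 = 1 := by
      obtain ⟨n, hn⟩ := Subgroup.mem_zpowers_iff.mp h2
      rw [← hn, ← zpow_natCast, zpow_comm, zpow_natCast, F.τ_cube, one_zpow]
    have h4 : (τ * d * τ⁻¹ * d⁻¹) ^ 4 = 1 := by
      have := pow_card_eq_one' (x := (⟨_, h1⟩ : Subgroup.closure {h, w}))
      rw [F.card_closure] at this
      exact congrArg Subtype.val this
    rw [pow_succ, h3, one_mul] at h4
    exact mul_inv_eq_one.mp h4
  rcases F.mem_closure_iff.mp hd with rfl | rfl | rfl | rfl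
  · rfl
  · exact absurd (hcomm.symm.trans F.conj_τ_h) F.h_ne_mul
  · exact absurd (F.conj_τ_w.symm.trans hcomm) F.h_ne_w
  · exact absurd (F.conj_τ_mul.symm.trans hcomm) F.w_ne_mul

/-- In the normalizer of the Klein four-group, the normalizer of `⟨τ⟩` is a complement. -/
theorem nonempty_normalizer_mulEquiv_perm (F : OctahedralFrame h w τ s) :
    Nonempty (Subgroup.normalizer (Subgroup.closure {h, w} : Set G) ≃* Equiv.Perm (Fin 4)) := by
  set V := Subgroup.closure {h, w} with hVdef
  set N := Subgroup.normalizer (V : Set G) with hN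
  have hVN : V ≤ N := Subgroup.le_normalizer
  set H := Subgroup.normalizer (Subgroup.zpowers τ : Set G) with hH
  have hτH : τ ∈ H := Subgroup.le_normalizer (Subgroup.mem_zpowers τ)
  have hsH : s ∈ H := by
    have : Finite (Subgroup.zpowers τ : Set G) := by
      have : IsOfFinOrder τ := isOfFinOrder_iff_pow_eq_one.mpr ⟨3, by omega, F.τ_cube⟩
      exact this.finite_zpowers
    refine Subgroup.mem_normalizer_fintype fun n hn => ?_
    obtain ⟨m, rfl⟩ := Subgroup.mem_zpowers_iff.mp hn
    rw [← conj_zpow, F.conj_s_τ]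
    exact zpow_mem (inv_mem (Subgroup.mem_zpowers τ)) m
  have : (V.subgroupOf N).Normal := Subgroup.normal_in_normalizer
  refine nonempty_mulEquiv_perm_of_isComplement' (V.subgroupOf N) (H.subgroupOf N) ?_ ?_ ?_ ?_
  · refine Subgroup.isComplement'_of_disjoint_and_mul_eq_univ ?_ ?_
    · rw [Subgroup.disjoint_def]
      intro x hx hx'
      exact Subtype.ext (F.eq_one_of_mem_normalizer_zpowers hx hx')
    · refine Set.eq_univ_of_forall fun x => ?_
      obtain ⟨i, -, j, -, d, hd, e⟩ := F.exists_eq_τ_pow_mul_s_pow_mul x.2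
      have hc : τ ^ i * s ^ j ∈ N :=
        mul_mem (pow_mem F.τ_mem_normalizer i) (pow_mem F.s_mem_normalizer j)
      refine Set.mem_mul.mpr ⟨⟨_, hVN ((Subgroup.mem_normalizer_iff.mp hc d).mp hd)⟩,
        (Subgroup.mem_normalizer_iff.mp hc d).mp hd, ⟨_, hc⟩,
        (mul_mem (pow_mem hτH i) (pow_mem hsH j) : _ ∈ H), Subtype.ext ?_⟩
      simp only [Subgroup.coe_mul, e]
      group
  · rw [← F.card_closure]
    exact Nat.card_congr (Subgroup.subgroupOfEquivOfLe hVN).toEquiv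
  · intro x hx
    have key : ∀ y ∈ V, x.1 * y * x.1⁻¹ = y := fun y hy => by
      have := congrArg Subtype.val
        (Subgroup.mem_centralizer_iff.mp hx ⟨y, hVN hy⟩ hy)
      simp only [Subgroup.coe_mul] at this
      rw [← this, mul_inv_cancel_right]
    exact F.centralizer_le x.1 (key h (Subgroup.subset_closure (by simp)))
      (key w (Subgroup.subset_closure (by simp)))
  · have h2 : 2 ∣ Nat.card (H.subgroupOf N) := by
      have := orderOf_dvd_natCard
        (⟨⟨s, F.s_mem_normalizer⟩, hsH⟩ : H.subgroupOf N)
      rwa [orderOf_eq_prime (p := 2)] at this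
      · exact Subtype.ext (Subtype.ext (by simpa [pow_two] using F.s_sq))
      · exact fun e => F.s_ne_one (congrArg (fun x => x.1.1) e)
    have h3 : 3 ∣ Nat.card (H.subgroupOf N) := by
      have := orderOf_dvd_natCard
        (⟨⟨τ, F.τ_mem_normalizer⟩, hτH⟩ : H.subgroupOf N)
      rwa [orderOf_eq_prime (p := 3)] at this
      · exact Subtype.ext (Subtype.ext F.τ_cube)
      · exact fun e => F.τ_ne_one (congrArg (fun x => x.1.1) e)
    omega

end OctahedralFrame

end OctahedralFrame

/-! ### The octahedral subgroup of the projective linear group -/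

section ProjectiveMatrices

variable {k : Type*} [Field k]

open Matrix (ProjGenLinGroup)

/-- The class in `PGL₂(k)` of a matrix with nonzero determinant. -/
noncomputable def pglMk (M : Matrix (Fin 2) (Fin 2) k) (hM : M.det ≠ 0) : PGL2 k :=
  ProjGenLinGroup.mk (Matrix.GeneralLinearGroup.mkOfDetNeZero M hM)

theorem pglMk_coe (A : GL (Fin 2) k) : pglMk A.1 A.det.ne_zero = ProjGenLinGroup.mk A :=
  congrArg (ProjGenLinGroup.mk (n := Fin 2) (R := k)) (Units.ext rfl)

theorem exists_eq_pglMk (x : PGL2 k) : ∃ M, ∃ hM : M.det ≠ 0, x = pglMk M hM := by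
  obtain ⟨A, rfl⟩ := ProjGenLinGroup.mk_surjective x
  exact ⟨A.1, A.det.ne_zero, (pglMk_coe A).symm⟩

theorem pglMk_mul (M N : Matrix (Fin 2) (Fin 2) k) (hM : M.det ≠ 0) (hN : N.det ≠ 0) :
    pglMk M hM * pglMk N hN = pglMk (M * N) (by rw [Matrix.det_mul]; exact mul_ne_zero hM hN) := by
  rw [pglMk, pglMk, pglMk, ← map_mul]
  exact congrArg _ (Units.ext rfl)

theorem pglMk_eq_iff {M N : Matrix (Fin 2) (Fin 2) k} {hM : M.det ≠ 0} {hN : N.det ≠ 0} :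
    pglMk M hM = pglMk N hN ↔ ∃ c : k, N = c • M := by
  rw [pglMk, pglMk, ProjGenLinGroup.mk_eq_mk_iff]
  constructor
  · rintro ⟨u, hu⟩
    refine ⟨u, ?_⟩
    have := congrArg Units.val hu
    simp only [Units.val_mul] at this
    change M * Matrix.scalar (Fin 2) (u : k) = N at this
    rw [← this, ← (Matrix.scalar_commute (u : k) (fun _ => Commute.all _ _) M).eq,
      Matrix.scalar_apply, ← Matrix.smul_eq_diagonal_mul]
  · rintro ⟨c, hc⟩
    have hc0 : c ≠ 0 := by
      rintro rfl
      exact hN (by simp [hc])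
    refine ⟨Units.mk0 c hc0, Units.ext ?_⟩
    change M * Matrix.scalar (Fin 2) c = N
    rw [hc, ← (Matrix.scalar_commute c (fun _ => Commute.all _ _) M).eq,
      Matrix.scalar_apply, ← Matrix.smul_eq_diagonal_mul]

theorem pglMk_one : pglMk (1 : Matrix (Fin 2) (Fin 2) k) (by simp) = 1 := by
  rw [← ProjGenLinGroup.mk_one]
  exact congrArg (ProjGenLinGroup.mk (n := Fin 2) (R := k)) (Units.ext rfl)

theorem pglMk_eq_one_iff {M : Matrix (Fin 2) (Fin 2) k} {hM : M.det ≠ 0} :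
    pglMk M hM = 1 ↔ ∃ c : k, M = c • (1 : Matrix (Fin 2) (Fin 2) k) := by
  rw [← pglMk_one, eq_comm, pglMk_eq_iff]

/-- The involutions of `PGL₂` are the classes of traceless matrices. -/
theorem trace_eq_zero_of_pglMk_sq {M : Matrix (Fin 2) (Fin 2) k} {hM : M.det ≠ 0}
    (hsq : pglMk M hM * pglMk M hM = 1) (hne : pglMk M hM ≠ 1) : M 0 0 + M 1 1 = 0 := by
  rw [pglMk_mul, pglMk_eq_one_iff] at hsq
  obtain ⟨c, hc⟩ := hsq
  by_contra ht
  refine hne (pglMk_eq_one_iff.mpr ⟨M 0 0, ?_⟩)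
  have e00 := congrFun (congrFun hc 0) 0
  have e01 := congrFun (congrFun hc 0) 1
  have e10 := congrFun (congrFun hc 1) 0
  have e11 := congrFun (congrFun hc 1) 1
  simp [Matrix.mul_apply, Fin.sum_univ_two] at e00 e01 e10 e11
  have h01 : M 0 1 = 0 := by
    refine (mul_eq_zero.mp (?_ : (M 0 0 + M 1 1) * M 0 1 = 0)).resolve_left ht
    linear_combination e01
  have h10 : M 1 0 = 0 := by
    refine (mul_eq_zero.mp (?_ : (M 0 0 + M 1 1) * M 1 0 = 0)).resolve_left ht
    linear_combination e10
  have h11 : M 1 1 = M 0 0 := by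
    refine sub_eq_zero.mp ((mul_eq_zero.mp
      (?_ : (M 0 0 + M 1 1) * (M 1 1 - M 0 0) = 0)).resolve_left ht)
    linear_combination e11 - e00
  ext i j
  fin_cases i <;> fin_cases j <;> simp [h01, h10, h11]

theorem pglClosure_eq_closure (S : Set (Matrix (Fin 2) (Fin 2) k)) :
    pglClosure S = Subgroup.closure {x | ∃ M ∈ S, ∃ hM : M.det ≠ 0, pglMk M hM = x} := by
  unfold pglClosure
  congr 1
  ext x
  constructor
  · rintro ⟨A, hA, rfl⟩
    exact ⟨A.1, hA, A.det.ne_zero, pglMk_coe A⟩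
  · rintro ⟨M, hM, hd, rfl⟩
    exact ⟨_, hM, rfl⟩

variable (k) in
/-- The class of `diag(1, -1)`. -/
noncomputable def pglH : PGL2 k := pglMk !![1, 0; 0, -1] (by simp)

variable (k) in
/-- The class of the quarter turn, which exchanges `t₀` and `t₁` up to sign. -/
noncomputable def pglW : PGL2 k := pglMk !![0, -1; 1, 0] (by simp)

/-- The element of order three attached to a primitive fourth root of unity `ω`; primitivity is
encoded as `ω * ω = -1`. -/
noncomputable def pglT (ω : k) (h2 : (2 : k) ≠ 0) (hω : ω * ω = -1) : PGL2 k :=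
  pglMk !![ω, -1; ω, 1] (by
    have : ω ≠ 0 := by rintro rfl; simp at hω
    rw [Matrix.det_fin_two_of]
    exact fun e => mul_ne_zero h2 this (by linear_combination e))

/-- The involution that commutes with the quarter turn and swaps the other two involutions of the
four-group. -/
noncomputable def pglS (h2 : (2 : k) ≠ 0) : PGL2 k :=
  pglMk !![-1, 1; 1, 1] (by
    rw [Matrix.det_fin_two_of]
    exact fun e => h2 (by linear_combination -e))

theorem dihedralD4_eq : dihedralD4 k = Subgroup.closure {pglH k, pglW k} := by
  rw [dihedralD4, pglClosure_eq_closure]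
  congr 1
  ext x
  simp only [Set.mem_ofPred_eq, Set.mem_insert_iff, Set.mem_singleton_iff]
  constructor
  · rintro ⟨M, rfl | rfl, hM, rfl⟩
    · exact Or.inl rfl
    · exact Or.inr rfl
  · rintro (rfl | rfl)
    · exact ⟨_, Or.inl rfl, _, rfl⟩
    · exact ⟨_, Or.inr rfl, _, rfl⟩

theorem pglClosure_octahedral_eq (ω : k) (h2 : (2 : k) ≠ 0) (hω : ω * ω = -1) :
    pglClosure {!![ω, -1; ω, 1], !![-1, 1; 1, 1], !![1, 0; 0, -1], !![0, -1; 1, 0]}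
      = Subgroup.closure {pglT ω h2 hω, pglS h2, pglH k, pglW k} := by
  rw [pglClosure_eq_closure]
  congr 1
  ext x
  simp only [Set.mem_ofPred_eq, Set.mem_insert_iff, Set.mem_singleton_iff]
  constructor
  · rintro ⟨M, rfl | rfl | rfl | rfl, hM, rfl⟩
    · exact Or.inl rfl
    · exact Or.inr (Or.inl rfl)
    · exact Or.inr (Or.inr (Or.inl rfl))
    · exact Or.inr (Or.inr (Or.inr rfl))
  · rintro (rfl | rfl | rfl | rfl)
    · exact ⟨_, Or.inl rfl, _, rfl⟩
    · exact ⟨_, Or.inr (Or.inl rfl), _, rfl⟩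
    · exact ⟨_, Or.inr (Or.inr (Or.inl rfl)), _, rfl⟩
    · exact ⟨_, Or.inr (Or.inr (Or.inr rfl)), _, rfl⟩

/-- A traceless matrix of one of the three shapes below represents an involution of the
four-group. -/
theorem pglMk_mem_closure_of_shape {M : Matrix (Fin 2) (Fin 2) k} (hM : M.det ≠ 0)
    (ht : M 0 0 + M 1 1 = 0)
    (h : (M 0 1 = 0 ∧ M 1 0 = 0) ∨ (M 0 0 = 0 ∧ (M 1 0 = M 0 1 ∨ M 1 0 = -M 0 1))) :
    pglMk M hM ∈ Subgroup.closure {pglH k, pglW k} := by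
  have h11 : M 1 1 = -M 0 0 := by linear_combination ht
  have hH : pglH k ∈ Subgroup.closure {pglH k, pglW k} := Subgroup.subset_closure (by simp)
  have hW : pglW k ∈ Subgroup.closure {pglH k, pglW k} := Subgroup.subset_closure (by simp)
  rcases h with ⟨h01, h10⟩ | ⟨h00, h | h⟩
  · convert hH using 1
    rw [pglH, eq_comm, pglMk_eq_iff]
    refine ⟨M 0 0, ?_⟩
    ext i j
    fin_cases i <;> fin_cases j <;> simp [h01, h10, h11]
  · convert mul_mem hH hW using 1
    rw [pglH, pglW, pglMk_mul, eq_comm, pglMk_eq_iff]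
    refine ⟨-M 0 1, ?_⟩
    ext i j
    fin_cases i <;> fin_cases j <;> simp [h00, h, h11]
  · convert hW using 1
    rw [pglW, eq_comm, pglMk_eq_iff]
    refine ⟨-M 0 1, ?_⟩
    ext i j
    fin_cases i <;> fin_cases j <;> simp [h00, h, h11]

/-- Over the matrices, commuting with the two generators holds up to signs; this leaves the diagonal
and antidiagonal matrices with entries equal up to sign, which represent the four-group. -/
theorem pgl_centralizer_le (h2 : (2 : k) ≠ 0) (g : PGL2 k)
    (hgh : g * pglH k * g⁻¹ = pglH k) (hgw : g * pglW k * g⁻¹ = pglW k) :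
    g ∈ Subgroup.closure {pglH k, pglW k} := by
  obtain ⟨M, hM, rfl⟩ := exists_eq_pglMk g
  rw [mul_inv_eq_iff_eq_mul, pglH, pglMk_mul, pglMk_mul, pglMk_eq_iff] at hgh
  rw [mul_inv_eq_iff_eq_mul, pglW, pglMk_mul, pglMk_mul, pglMk_eq_iff] at hgw
  obtain ⟨c, hc⟩ := hgh
  obtain ⟨d, hd⟩ := hgw
  have c00 := congrFun (congrFun hc 0) 0
  have c01 := congrFun (congrFun hc 0) 1
  have c10 := congrFun (congrFun hc 1) 0
  have c11 := congrFun (congrFun hc 1) 1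
  have d00 := congrFun (congrFun hd 0) 0
  have d01 := congrFun (congrFun hd 0) 1
  have d10 := congrFun (congrFun hd 1) 0
  have d11 := congrFun (congrFun hd 1) 1
  simp [Matrix.mul_apply, Fin.sum_univ_two] at c00 c01 c10 c11 d00 d01 d10 d11
  have hdet := hM
  rw [Matrix.det_fin_two] at hdet
  by_cases h00 : M 0 0 = 0
  · have h10 : M 1 0 ≠ 0 := fun e => hdet (by rw [h00, e]; ring)
    have hc1 : c = -1 := mul_right_cancel₀ h10 (by linear_combination -c10)
    have h11 : M 1 1 = 0 := (mul_eq_zero.mp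
      (by linear_combination c11 + M 1 1 * hc1 : 2 * M 1 1 = 0)).resolve_left h2
    refine pglMk_mem_closure_of_shape hM (by rw [h00, h11, add_zero]) (Or.inr ⟨h00, ?_⟩)
    exact sq_eq_sq_iff_eq_or_eq_neg.mp (by linear_combination -M 1 0 * d00 - M 0 1 * d11)
  · have hc1 : c = 1 := mul_right_cancel₀ h00 (by linear_combination -c00)
    have h01 : M 0 1 = 0 := (mul_eq_zero.mp
      (by linear_combination c01 - M 0 1 * hc1 : 2 * M 0 1 = 0)).resolve_left h2
    have h10 : M 1 0 = 0 := (mul_eq_zero.mp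
      (by linear_combination -c10 - M 1 0 * hc1 : 2 * M 1 0 = 0)).resolve_left h2
    rcases sq_eq_sq_iff_eq_or_eq_neg.mp
      (by linear_combination M 1 1 * d01 - M 0 0 * d10 : M 1 1 ^ 2 = M 0 0 ^ 2) with h | h
    · have : pglMk M hM = 1 := by
        rw [pglMk_eq_one_iff]
        refine ⟨M 0 0, ?_⟩
        ext i j
        fin_cases i <;> fin_cases j <;> simp [h01, h10, h]
      rw [this]
      exact one_mem _
    · exact pglMk_mem_closure_of_shape hM (by rw [h, add_neg_cancel]) (Or.inl ⟨h01, h10⟩)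

theorem pglS_mul_self (h2 : (2 : k) ≠ 0) : pglS h2 * pglS h2 = 1 := by
  rw [pglS, pglMk_mul, pglMk_eq_one_iff]
  refine ⟨2, ?_⟩
  ext i j
  fin_cases i <;> fin_cases j <;> norm_num

theorem pgl_octahedralFrame (ω : k) (h2 : (2 : k) ≠ 0) (hω : ω * ω = -1) :
    OctahedralFrame (pglH k) (pglW k) (pglT ω h2 hω) (pglS h2) where
  h_sq := by
    rw [pglH, pglMk_mul, pglMk_eq_one_iff]
    exact ⟨1, by ext i j; fin_cases i <;> fin_cases j <;> simp⟩
  w_sq := by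
    rw [pglW, pglMk_mul, pglMk_eq_one_iff]
    exact ⟨-1, by ext i j; fin_cases i <;> fin_cases j <;> simp⟩
  comm := by
    rw [pglH, pglW, pglMk_mul, pglMk_mul, pglMk_eq_iff]
    exact ⟨-1, by ext i j; fin_cases i <;> fin_cases j <;> simp⟩
  h_ne := by
    rw [pglH, Ne, pglMk_eq_one_iff]
    rintro ⟨c, hc⟩
    have e0 := congrFun (congrFun hc 0) 0
    have e1 := congrFun (congrFun hc 1) 1
    simp at e0 e1
    exact h2 (by linear_combination e0 - e1)
  w_ne := by
    rw [pglW, Ne, pglMk_eq_one_iff]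
    rintro ⟨c, hc⟩
    have e0 := congrFun (congrFun hc 1) 0
    simp at e0
  h_ne_w := by
    rw [pglW, pglH, Ne, pglMk_eq_iff]
    rintro ⟨c, hc⟩
    have e0 := congrFun (congrFun hc 1) 0
    simp at e0
  conj_τ_h := by
    rw [mul_inv_eq_iff_eq_mul, pglH, pglW, pglT, pglMk_mul, pglMk_mul, pglMk_mul, pglMk_eq_iff]
    refine ⟨-1, ?_⟩
    ext i j; fin_cases i <;> fin_cases j <;> simp
  conj_τ_w := by
    rw [mul_inv_eq_iff_eq_mul, pglH, pglW, pglT, pglMk_mul, pglMk_mul, pglMk_eq_iff]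
    refine ⟨-ω, ?_⟩
    ext i j; fin_cases i <;> fin_cases j <;> simp [hω]
  conj_s_h := by
    rw [mul_inv_eq_iff_eq_mul, pglH, pglW, pglS, pglMk_mul, pglMk_mul, pglMk_mul, pglMk_eq_iff]
    refine ⟨1, ?_⟩
    ext i j; fin_cases i <;> fin_cases j <;> simp
  conj_s_w := by
    rw [mul_inv_eq_iff_eq_mul, pglW, pglS, pglMk_mul, pglMk_mul, pglMk_eq_iff]
    refine ⟨-1, ?_⟩
    ext i j; fin_cases i <;> fin_cases j <;> simp
  τ_cube := by
    rw [pow_succ, pow_two, pglT, pglMk_mul, pglMk_mul, pglMk_eq_one_iff]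
    refine ⟨-2 * (1 + ω) * ω, ?_⟩
    ext i j; fin_cases i <;> fin_cases j <;> simp
    · linear_combination ω * hω
    · linear_combination -hω
    · linear_combination ω * hω
    · linear_combination hω
  s_sq := pglS_mul_self h2
  conj_s_τ := by
    have hs : (pglS h2)⁻¹ = pglS h2 := inv_eq_of_mul_eq_one_left (pglS_mul_self h2)
    rw [hs, eq_inv_iff_mul_eq_one, pglS, pglT, pglMk_mul, pglMk_mul, pglMk_mul, pglMk_eq_one_iff]
    refine ⟨4 * ω, ?_⟩
    ext i j; fin_cases i <;> fin_cases j <;> simp <;> ring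
  centralizer_le := pgl_centralizer_le h2

end ProjectiveMatrices

/-! ### The action on the pencils -/

namespace Pencil

variable {k : Type*} [Field k]

/-- The binary cubic `u₀ t₀³ + u₁ t₀² t₁ + u₂ t₀ t₁² + u₃ t₁³`. -/
noncomputable def cubic (u₀ u₁ u₂ u₃ : k) : MvPolynomial (Fin 2) k :=
  C u₀ * X 0 ^ 3 + C u₁ * (X 0 ^ 2 * X 1) + C u₂ * (X 0 * X 1 ^ 2) + C u₃ * X 1 ^ 3

/-- The coefficients of a binary cubic determine it. -/
theorem cubic_inj {u₀ u₁ u₂ u₃ v₀ v₁ v₂ v₃ : k} (h : cubic u₀ u₁ u₂ u₃ = cubic v₀ v₁ v₂ v₃) :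
    u₀ = v₀ ∧ u₁ = v₁ ∧ u₂ = v₂ ∧ u₃ = v₃ := by
  have key : ∀ (c d : ℕ) (w₀ w₁ w₂ w₃ : k),
      lcoeff k (Finsupp.single (0 : Fin 2) c + Finsupp.single 1 d) (cubic w₀ w₁ w₂ w₃)
        = w₀ * (if 3 = c ∧ 0 = d then 1 else 0) + w₁ * (if 2 = c ∧ 1 = d then 1 else 0)
          + w₂ * (if 1 = c ∧ 2 = d then 1 else 0) + w₃ * (if 0 = c ∧ 3 = d then 1 else 0) := by
    intro c d w₀ w₁ w₂ w₃
    rw [← coeff_X_pow_mul, ← coeff_X_pow_mul, ← coeff_X_pow_mul, ← coeff_X_pow_mul]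
    simp only [cubic, ← smul_eq_C_mul, map_add, map_smul, smul_eq_mul, pow_zero, pow_one, one_mul,
      mul_one]
  have compare := fun c d => (key c d u₀ u₁ u₂ u₃).symm.trans
    ((congrArg (lcoeff k (Finsupp.single (0 : Fin 2) c + Finsupp.single 1 d)) h).trans
      (key c d v₀ v₁ v₂ v₃))
  refine ⟨?_, ?_, ?_, ?_⟩
  · simpa using compare 3 0
  · simpa using compare 2 1
  · simpa using compare 1 2
  · simpa using compare 0 3

theorem cubic_mem_wallFinite_iff {r u₀ u₁ u₂ u₃ : k} :
    cubic u₀ u₁ u₂ u₃ ∈ (wallFinite r).carrier ↔ u₂ = r * u₀ ∧ u₁ = r * u₃ := by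
  change _ ∈ Submodule.span k {_, _} ↔ _
  rw [Submodule.mem_span_pair]
  have key : ∀ a b : k, a • (X 0 ^ 3 + C r * (X 0 * X 1 ^ 2) : MvPolynomial (Fin 2) k)
      + b • (C r * (X 0 ^ 2 * X 1) + X 1 ^ 3) = cubic a (r * b) (r * a) b := by
    intro a b
    simp only [cubic, smul_eq_C_mul, C_mul]
    ring
  constructor
  · rintro ⟨a, b, hab⟩
    rw [key] at hab
    obtain ⟨rfl, rfl, rfl, rfl⟩ := cubic_inj hab
    exact ⟨rfl, rfl⟩
  · rintro ⟨rfl, rfl⟩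
    exact ⟨u₀, u₃, key _ _⟩

theorem cubic_mem_wallInfty {u₀ u₁ u₂ u₃ : k} (h₀ : u₀ = 0) (h₃ : u₃ = 0) :
    cubic u₀ u₁ u₂ u₃ ∈ (wallInfty (k := k)).carrier := by
  subst h₀ h₃
  change _ ∈ Submodule.span k {_, _}
  rw [Submodule.mem_span_pair]
  refine ⟨u₂, u₁, ?_⟩
  simp only [cubic, smul_eq_C_mul, C_0]
  ring

theorem wallFinite_carrier (r : k) :
    (wallFinite r).carrier = Submodule.span k {cubic 1 0 r 0, cubic 0 r 0 1} := by
  have h1 : cubic 1 0 r 0 = X 0 ^ 3 + C r * (X 0 * X 1 ^ 2) := by simp [cubic]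
  have h2 : cubic 0 r 0 1 = C r * (X 0 ^ 2 * X 1) + X 1 ^ 3 := by simp [cubic]
  rw [h1, h2]
  rfl

theorem wallInfty_carrier :
    (wallInfty (k := k)).carrier = Submodule.span k {cubic 0 0 1 0, cubic 0 1 0 0} := by
  have h1 : cubic (0 : k) 0 1 0 = X 0 * X 1 ^ 2 := by simp [cubic]
  have h2 : cubic (0 : k) 1 0 0 = X 0 ^ 2 * X 1 := by simp [cubic]
  rw [h1, h2]
  rfl

theorem eq_of_carrier_le {p q : Pencil k} (h : p.carrier ≤ q.carrier) : p = q := by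
  have : FiniteDimensional k q.carrier := Module.finite_of_finrank_pos (by simp [q.finrank_eq])
  exact Pencil.ext (Submodule.eq_of_le_of_finrank_eq h (p.finrank_eq.trans q.finrank_eq.symm))

theorem pglMk_smul_eq {M : Matrix (Fin 2) (Fin 2) k} {hM : M.det ≠ 0} {p q : Pencil k}
    {f g : MvPolynomial (Fin 2) k} (hp : p.carrier = Submodule.span k {f, g})
    (hf : formAct M f ∈ q.carrier) (hg : formAct M g ∈ q.carrier) : pglMk M hM • p = q := by
  refine eq_of_carrier_le ?_
  rw [pglMk, mk_smul, GL_smul_carrier, hp, Submodule.map_span_le]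
  rintro x (rfl | rfl)
  exacts [hf, hg]

theorem formAct_mem_of_pglMk_smul_eq {M : Matrix (Fin 2) (Fin 2) k} {hM : M.det ≠ 0}
    {p q : Pencil k} (h : pglMk M hM • p = q) {f : MvPolynomial (Fin 2) k} (hf : f ∈ p.carrier) :
    formAct M f ∈ q.carrier := by
  rw [← h, pglMk, mk_smul, GL_smul_carrier]
  exact ⟨f, hf, rfl⟩

theorem formAct_cubic (M : Matrix (Fin 2) (Fin 2) k) (u₀ u₁ u₂ u₃ : k) :
    formAct M (cubic u₀ u₁ u₂ u₃) = cubic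
      (u₀ * M 0 0 ^ 3 + u₁ * (M 0 0 ^ 2 * M 0 1) + u₂ * (M 0 0 * M 0 1 ^ 2) + u₃ * M 0 1 ^ 3)
      (3 * u₀ * M 0 0 ^ 2 * M 1 0 + u₁ * (M 0 0 ^ 2 * M 1 1 + 2 * M 0 0 * M 1 0 * M 0 1)
        + u₂ * (M 1 0 * M 0 1 ^ 2 + 2 * M 0 0 * M 0 1 * M 1 1) + 3 * u₃ * M 0 1 ^ 2 * M 1 1)
      (3 * u₀ * M 0 0 * M 1 0 ^ 2 + u₁ * (M 1 0 ^ 2 * M 0 1 + 2 * M 0 0 * M 1 0 * M 1 1)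
        + u₂ * (M 0 0 * M 1 1 ^ 2 + 2 * M 1 0 * M 0 1 * M 1 1) + 3 * u₃ * M 0 1 * M 1 1 ^ 2)
      (u₀ * M 1 0 ^ 3 + u₁ * (M 1 0 ^ 2 * M 1 1) + u₂ * (M 1 0 * M 1 1 ^ 2) + u₃ * M 1 1 ^ 3) := by
  simp only [cubic, map_add, map_mul, map_pow, formAct_X, Fin.sum_univ_two, algHom_C,
    algebraMap_eq, map_ofNat]
  ring

theorem pglH_smul_wallFinite (r : k) : pglH k • wallFinite r = wallFinite r := by
  refine pglMk_smul_eq (wallFinite_carrier r) ?_ ?_ <;>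
    rw [formAct_cubic, cubic_mem_wallFinite_iff] <;> constructor <;> simp [pow_succ]

theorem pglW_smul_wallFinite (r : k) : pglW k • wallFinite r = wallFinite r := by
  refine pglMk_smul_eq (wallFinite_carrier r) ?_ ?_ <;>
    rw [formAct_cubic, cubic_mem_wallFinite_iff] <;> constructor <;> simp [pow_succ]

theorem closure_smul_wallFinite {x : PGL2 k} (hx : x ∈ Subgroup.closure {pglH k, pglW k}) (r : k) :
    x • wallFinite r = wallFinite r := by
  have h : Subgroup.closure {pglH k, pglW k} ≤ MulAction.stabilizer (PGL2 k) (wallFinite r) := by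
    rw [Subgroup.closure_le]
    rintro y (rfl | rfl)
    exacts [pglH_smul_wallFinite r, pglW_smul_wallFinite r]
  exact h hx

theorem pglT_smul_wallFinite (ω : k) (h2 : (2 : k) ≠ 0) (hω : ω * ω = -1) {r : k}
    (hr : r - 1 ≠ 0) : pglT ω h2 hω • wallFinite r = wallFinite (-((r + 3) / (r - 1))) := by
  refine pglMk_smul_eq (wallFinite_carrier r) ?_ ?_ <;>
    rw [formAct_cubic, cubic_mem_wallFinite_iff] <;> constructor <;> simp <;> field_simp <;>
    rw [(pow_two ω).trans hω] <;> ring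

theorem pglS_smul_wallFinite (h2 : (2 : k) ≠ 0) {r : k}
    (hr : r + 1 ≠ 0) : pglS h2 • wallFinite r = wallFinite (-((r - 3) / (r + 1))) := by
  refine pglMk_smul_eq (wallFinite_carrier r) ?_ ?_ <;>
    rw [formAct_cubic, cubic_mem_wallFinite_iff] <;> constructor <;> simp <;> field_simp <;> ring

theorem pglT_smul_wallFinite_one (ω : k) (h2 : (2 : k) ≠ 0) (hω : ω * ω = -1) :
    pglT ω h2 hω • wallFinite (1 : k) = wallInfty := by
  refine pglMk_smul_eq (wallFinite_carrier 1) ?_ ?_ <;> rw [formAct_cubic] <;>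
    refine cubic_mem_wallInfty ?_ ?_ <;> simp
  · linear_combination ω * hω
  · linear_combination ω * hω
  · linear_combination -hω
  · linear_combination hω

theorem pglS_smul_wallFinite_neg_one (h2 : (2 : k) ≠ 0) :
    pglS h2 • wallFinite (-1 : k) = wallInfty := by
  refine pglMk_smul_eq (wallFinite_carrier (-1)) ?_ ?_ <;> rw [formAct_cubic] <;>
    refine cubic_mem_wallInfty ?_ ?_ <;> simp [pow_succ]

/-! ### Degenerate pencils -/

/-- A pencil fixed by all classes of diagonal matrices has infinite stabilizer. -/
theorem infinite_stabilizer_of_torus [Infinite k] {p : Pencil k}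
    (h : ∀ (x : k) (hx : (!![1, 0; 0, x]).det ≠ 0), pglMk !![1, 0; 0, x] hx • p = p) :
    ¬ Finite (MulAction.stabilizer (PGL2 k) p) := by
  intro hfin
  have hdet : ∀ x : kˣ, (!![1, 0; 0, (x : k)]).det ≠ 0 := fun x => by simp
  have : Finite kˣ := Finite.of_injective
    (fun x : kˣ => (⟨pglMk _ (hdet x), h _ _⟩ : MulAction.stabilizer (PGL2 k) p)) (by
      intro x y hxy
      obtain ⟨c, hc⟩ := pglMk_eq_iff.mp (congrArg Subtype.val hxy)
      have e0 := congrFun (congrFun hc 0) 0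
      have e1 := congrFun (congrFun hc 1) 1
      simp at e0 e1
      exact Units.ext (by rw [e1, ← e0, one_mul]))
  refine Set.infinite_univ (α := k) (((Set.finite_range (Units.val : kˣ → k)).insert 0).subset
    fun x _ => ?_)
  by_cases hx : x = 0
  · exact Or.inl hx
  · exact Or.inr ⟨Units.mk0 x hx, rfl⟩

theorem infinite_stabilizer_wallFinite_zero [Infinite k] :
    ¬ Finite (MulAction.stabilizer (PGL2 k) (wallFinite (0 : k))) := by
  refine infinite_stabilizer_of_torus fun x hx => pglMk_smul_eq (wallFinite_carrier 0) ?_ ?_ <;>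
    rw [formAct_cubic, cubic_mem_wallFinite_iff] <;> constructor <;> simp

theorem infinite_stabilizer_wallInfty [Infinite k] :
    ¬ Finite (MulAction.stabilizer (PGL2 k) (wallInfty (k := k))) := by
  refine infinite_stabilizer_of_torus fun x hx => pglMk_smul_eq wallInfty_carrier ?_ ?_ <;>
    rw [formAct_cubic] <;> refine cubic_mem_wallInfty ?_ ?_ <;> simp

/-- For the excluded values of `ρ` the pencil is conjugate to `p₀` or `p_∞`, hence is stabilized
by a torus. -/
theorem ne_of_finite_stabilizer [Infinite k] {ω : k} (hω : ω * ω = -1)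
    (h2 : (2 : k) ≠ 0) {r : k}
    (hfin : Finite (MulAction.stabilizer (PGL2 k) (wallFinite r))) :
    r ≠ 0 ∧ r ^ 2 ≠ 1 ∧ r ^ 2 ≠ 9 := by
  have move : ∀ {p q : Pencil k} (g : PGL2 k), g • p = q →
      Finite (MulAction.stabilizer (PGL2 k) p) → Finite (MulAction.stabilizer (PGL2 k) q) :=
    fun g h _ => Finite.of_equiv _ (MulAction.stabilizerEquivStabilizer h.symm).toEquiv
  have h4 : (4 : k) ≠ 0 := fun e => mul_ne_zero h2 h2 (by linear_combination e)
  have hr0 : r ≠ 0 := by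
    rintro rfl
    exact infinite_stabilizer_wallFinite_zero hfin
  refine ⟨hr0, fun h => ?_, fun h => ?_⟩
  · rcases sq_eq_sq_iff_eq_or_eq_neg.mp (by linear_combination h : r ^ 2 = 1 ^ 2) with rfl | rfl
    · exact infinite_stabilizer_wallInfty (move _ (pglT_smul_wallFinite_one ω h2 hω) hfin)
    · exact infinite_stabilizer_wallInfty (move _ (pglS_smul_wallFinite_neg_one h2) hfin)
  · rcases sq_eq_sq_iff_eq_or_eq_neg.mp (by linear_combination h : r ^ 2 = 3 ^ 2) with rfl | rfl
    · refine infinite_stabilizer_wallFinite_zero (move (pglS h2) ?_ hfin)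
      rw [pglS_smul_wallFinite h2 (fun e => h4 (by linear_combination e))]
      simp
    · refine infinite_stabilizer_wallFinite_zero (move (pglT ω h2 hω) ?_ hfin)
      rw [pglT_smul_wallFinite ω h2 hω (fun e => h4 (by linear_combination -e))]
      simp

/-! ### Involutions stabilizing a pencil -/

/-- The only involutions stabilizing `p_ρ`, for `ρ` not among the excluded values, are those of
the four-group. -/
theorem involution_mem_closure {r : k} (hr0 : r ≠ 0) (hr1 : r ^ 2 ≠ 1)
    (hr9 : r ^ 2 ≠ 9) {x : PGL2 k} (hsq : x * x = 1) (hx : x • wallFinite r = wallFinite r) :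
    x ∈ Subgroup.closure {pglH k, pglW k} := by
  by_cases hx1 : x = 1
  · rw [hx1]; exact one_mem _
  obtain ⟨M, hM, rfl⟩ := exists_eq_pglMk x
  have ht := trace_eq_zero_of_pglMk_sq hsq hx1
  refine pglMk_mem_closure_of_shape hM ht ?_
  have hd : M 1 1 = -M 0 0 := by linear_combination ht
  have hf := formAct_mem_of_pglMk_smul_eq hx
    (by rw [cubic_mem_wallFinite_iff]; simp : cubic 1 0 r 0 ∈ (wallFinite r).carrier)
  have hg := formAct_mem_of_pglMk_smul_eq hx
    (by rw [cubic_mem_wallFinite_iff]; simp : cubic 0 r 0 1 ∈ (wallFinite r).carrier)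
  rw [formAct_cubic, cubic_mem_wallFinite_iff, hd] at hf hg
  rw [Matrix.det_fin_two, hd] at hM
  set a := M 0 0
  set b := M 0 1
  set c := M 1 0
  clear_value a b c
  have e1 : a * ((c - r * b) * (3 * c + r * b)) = 0 := by linear_combination hf.1
  have e2 : a ^ 2 * (3 * c - 2 * r * b - r ^ 2 * c) + r * c * (b ^ 2 - c ^ 2) = 0 := by
    linear_combination hf.2
  have e3 : a * ((b - r * c) * (3 * b + r * c)) = 0 := by linear_combination -hg.2
  have e4 : a ^ 2 * (3 * b - 2 * r * c - r ^ 2 * b) + r * b * (c ^ 2 - b ^ 2) = 0 := by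
    linear_combination hg.1
  by_cases ha : a = 0
  · refine Or.inr ⟨ha, sq_eq_sq_iff_eq_or_eq_neg.mp ?_⟩
    have hbc : b * c ≠ 0 := fun e => hM (by rw [ha]; linear_combination -e)
    refine (sub_eq_zero.mp ((mul_eq_zero.mp (?_ : r * c * (b ^ 2 - c ^ 2) = 0)).resolve_left
      (mul_ne_zero hr0 (right_ne_zero_of_mul hbc)))).symm
    rw [ha] at e2
    linear_combination e2
  · left
    have e1' := (mul_eq_zero.mp e1).resolve_left ha
    have e3' := (mul_eq_zero.mp e3).resolve_left ha
    by_cases hb : b = 0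
    · refine ⟨hb, (mul_eq_zero.mp ?_).resolve_left (pow_ne_zero 2 hr0)⟩
      refine pow_eq_zero_iff (n := 2) two_ne_zero |>.mp ?_
      rw [hb] at e3'
      linear_combination -r ^ 2 * e3'
    by_cases hc : c = 0
    · refine absurd ((mul_eq_zero.mp ?_).resolve_left (pow_ne_zero 2 hr0)) hb
      refine pow_eq_zero_iff (n := 2) two_ne_zero |>.mp ?_
      rw [hc] at e1'
      linear_combination -r ^ 2 * e1'
    exfalso
    have hr1' : 1 - r ^ 2 ≠ 0 := fun e => hr1 (by linear_combination -e)
    rcases mul_eq_zero.mp e1' with h | h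
    · -- With `c = ρ b` the determinant of the matrix vanishes.
      have hcb : c = r * b := by linear_combination h
      rw [hcb] at e2 hM
      refine hM ((mul_eq_zero.mp ?_).resolve_left (mul_ne_zero (mul_ne_zero hr0 hb) hr1'))
      linear_combination -e2
    rcases mul_eq_zero.mp e3' with h' | h'
    · have hbc : b = r * c := by linear_combination h'
      rw [hbc] at e4 hM
      refine hM ((mul_eq_zero.mp ?_).resolve_left (mul_ne_zero (mul_ne_zero hr0 hc) hr1'))
      linear_combination -e4
    · refine hr9 (sub_eq_zero.mp ((mul_eq_zero.mp ?_).resolve_right hc))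
      linear_combination r * h' - 3 * h

end Pencil

namespace Pencil

variable {k : Type*} [Field k]

theorem wallFinite_injective : Function.Injective (wallFinite (k := k)) := by
  intro r r' h
  have hmem : cubic 1 0 r 0 ∈ (wallFinite r).carrier := by
    rw [cubic_mem_wallFinite_iff]; simp
  rw [h, cubic_mem_wallFinite_iff] at hmem
  simpa using hmem.1

/-! ### Stabilizers, their normalizers and orbits -/

theorem octahedralS4_eq :
    octahedralS4 k = Subgroup.normalizer (Subgroup.closure {pglH k, pglW k} : Set (PGL2 k)) := by
  rw [octahedralS4, dihedralD4_eq]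

/-- Conjugating the four-group by an element carrying a nondegenerate pencil `p_ρ` to `p_ρ'` gives
involutions that stabilize `p_ρ'`, so the four-group is normalized. -/
theorem mem_octahedralS4_of_smul_eq {ω : k} (hω : ω * ω = -1) (h2 : (2 : k) ≠ 0) {p : Pencil k}
    {r : k} (hr0 : r ≠ 0) (hr1 : r ^ 2 ≠ 1) (hr9 : r ^ 2 ≠ 9)
    (hp : ∀ d ∈ Subgroup.closure {pglH k, pglW k}, d • p = p) {x : PGL2 k}
    (hx : x • p = wallFinite r) : x ∈ octahedralS4 k := by
  have F := pgl_octahedralFrame ω h2 hω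
  have key : ∀ d ∈ Subgroup.closure {pglH k, pglW k}, d * d = 1 →
      x * d * x⁻¹ ∈ Subgroup.closure {pglH k, pglW k} := by
    intro d hd hsq
    refine involution_mem_closure hr0 hr1 hr9 ?_ ?_
    · rw [← conj_mul_right, hsq, mul_one, mul_inv_cancel]
    · rw [mul_smul, mul_smul, inv_smul_eq_iff.mpr hx.symm, hp d hd, hx]
  rw [octahedralS4_eq]
  exact F.mem_normalizer_of (key _ (Subgroup.subset_closure (by simp)) F.h_sq)
    (key _ (Subgroup.subset_closure (by simp)) F.w_sq)

/-- The six images of `p_ρ` under the cosets of the four-group. -/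
theorem pow_smul_wallFinite {ω : k} (hω : ω * ω = -1) (h2 : (2 : k) ≠ 0) {r : k}
    (hr : r - 1 ≠ 0) (hr' : r + 1 ≠ 0) :
    pglT ω h2 hω • wallFinite r = wallFinite (-((r + 3) / (r - 1))) ∧
    pglT ω h2 hω ^ 2 • wallFinite r = wallFinite ((r - 3) / (r + 1)) ∧
    pglS h2 • wallFinite r = wallFinite (-((r - 3) / (r + 1))) ∧
    pglT ω h2 hω • pglS h2 • wallFinite r = wallFinite ((r + 3) / (r - 1)) ∧
    pglT ω h2 hω ^ 2 • pglS h2 • wallFinite r = wallFinite (-r) := by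
  have hτ := pglT_smul_wallFinite ω h2 hω hr
  have hs := pglS_smul_wallFinite h2 hr'
  have h4 : (4 : k) ≠ 0 := fun e => mul_ne_zero h2 h2 (by linear_combination e)
  have n1 : -((r + 3) / (r - 1)) - 1 ≠ 0 := by
    have : -((r + 3) / (r - 1)) - 1 = -(2 * (r + 1)) / (r - 1) := by field_simp; ring
    rw [this]
    exact div_ne_zero (neg_ne_zero.mpr (mul_ne_zero h2 hr')) hr
  have n2 : -((r - 3) / (r + 1)) - 1 ≠ 0 := by
    have : -((r - 3) / (r + 1)) - 1 = -(2 * (r - 1)) / (r + 1) := by field_simp; ring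
    rw [this]
    exact div_ne_zero (neg_ne_zero.mpr (mul_ne_zero h2 hr)) hr'
  have n3 : (r + 3) / (r - 1) - 1 ≠ 0 := by
    have : (r + 3) / (r - 1) - 1 = 4 / (r - 1) := by field_simp; ring
    rw [this]
    exact div_ne_zero h4 hr
  have hτs : pglT ω h2 hω • pglS h2 • wallFinite r = wallFinite ((r + 3) / (r - 1)) := by
    rw [hs, pglT_smul_wallFinite ω h2 hω n2]
    congr 1
    rw [← neg_div, div_eq_iff n2]
    field_simp
    ring
  refine ⟨hτ, ?_, hs, hτs, ?_⟩
  · rw [pow_two, mul_smul, hτ, pglT_smul_wallFinite ω h2 hω n1]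
    congr 1
    rw [← neg_div, div_eq_iff n1]
    field_simp
    ring
  · rw [pow_two, mul_smul, hτs, pglT_smul_wallFinite ω h2 hω n3]
    congr 1
    rw [← neg_div, div_eq_iff n3]
    field_simp
    ring

theorem pglT_smul_wallFinite_of_sq_eq {ω : k} (hω : ω * ω = -1) (h2 : (2 : k) ≠ 0) {r : k}
    (hr : r - 1 ≠ 0) (h : r ^ 2 = -3) : pglT ω h2 hω • wallFinite r = wallFinite r := by
  rw [pglT_smul_wallFinite ω h2 hω hr]
  congr 1
  field_simp
  linear_combination -h

/-- A stabilizing element outside the four-group has order three modulo it, and exists only for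
`ρ² = -3`. -/
theorem mem_closure_or_of_smul_eq {ω : k} (hω : ω * ω = -1) (h2 : (2 : k) ≠ 0) {r : k}
    (hr0 : r ≠ 0) (hr1 : r ^ 2 ≠ 1) (hr9 : r ^ 2 ≠ 9) {x : PGL2 k}
    (hx : x • wallFinite r = wallFinite r) :
    x ∈ Subgroup.closure {pglH k, pglW k} ∨ r ^ 2 = -3 ∧
      ∃ i, ∃ d ∈ Subgroup.closure {pglH k, pglW k}, x = pglT ω h2 hω ^ i * d := by
  have F := pgl_octahedralFrame ω h2 hω
  have hr : r - 1 ≠ 0 := fun e => hr1 (by linear_combination (r + 1) * e)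
  have hr' : r + 1 ≠ 0 := fun e => hr1 (by linear_combination (r - 1) * e)
  have hr3 : r - 3 ≠ 0 := fun e => hr9 (by linear_combination (r + 3) * e)
  have hr3' : r + 3 ≠ 0 := fun e => hr9 (by linear_combination (r - 3) * e)
  have hxN := mem_octahedralS4_of_smul_eq hω h2 hr0 hr1 hr9
    (fun d hd => closure_smul_wallFinite hd r) hx
  rw [octahedralS4_eq] at hxN
  obtain ⟨hτ, hτ2, hs, hτs, hτ2s⟩ := pow_smul_wallFinite hω h2 hr hr'
  obtain ⟨i, hi, j, hj, d, hd, rfl⟩ := F.exists_eq_τ_pow_mul_s_pow_mul hxN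
  rw [mul_smul, mul_smul, closure_smul_wallFinite hd] at hx
  interval_cases j
  · rw [pow_zero, one_smul] at hx
    rw [pow_zero, mul_one]
    interval_cases i
    · left
      rwa [pow_zero, one_mul]
    · refine Or.inr ⟨?_, 1, d, hd, rfl⟩
      rw [pow_one, hτ] at hx
      have := wallFinite_injective hx
      field_simp at this
      linear_combination -this
    · refine Or.inr ⟨?_, 2, d, hd, rfl⟩
      rw [hτ2] at hx
      have := wallFinite_injective hx
      field_simp at this
      linear_combination -this
  · exfalso
    rw [pow_one] at hx
    interval_cases i
    · rw [pow_zero, one_smul, hs] at hx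
      have := wallFinite_injective hx
      field_simp at this
      exact mul_ne_zero hr hr3' (by linear_combination -this)
    · rw [pow_one, hτs] at hx
      have := wallFinite_injective hx
      field_simp at this
      exact mul_ne_zero hr' hr3 (by linear_combination -this)
    · rw [hτ2s] at hx
      have := wallFinite_injective hx
      exact mul_ne_zero h2 hr0 (by linear_combination -this)

theorem smul_wallFinite_mem {ω : k} (hω : ω * ω = -1) (h2 : (2 : k) ≠ 0) {r : k}
    (hr : r - 1 ≠ 0) (hr' : r + 1 ≠ 0) {g : PGL2 k} (hg : g ∈ octahedralS4 k) :
    g • wallFinite r ∈ ({wallFinite r, wallFinite (-r), wallFinite ((r + 3) / (r - 1)),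
      wallFinite (-((r + 3) / (r - 1))), wallFinite ((r - 3) / (r + 1)),
      wallFinite (-((r - 3) / (r + 1)))} : Set (Pencil k)) := by
  rw [octahedralS4_eq] at hg
  obtain ⟨hτ, hτ2, hs, hτs, hτ2s⟩ := pow_smul_wallFinite hω h2 hr hr'
  obtain ⟨i, hi, j, hj, d, hd, rfl⟩ :=
    (pgl_octahedralFrame ω h2 hω).exists_eq_τ_pow_mul_s_pow_mul hg
  rw [mul_smul, mul_smul, closure_smul_wallFinite hd]
  interval_cases j <;> interval_cases i <;>
    simp only [pow_zero, pow_one, one_smul, hτ, hτ2, hτs, hτ2s] <;> simp [hs]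

theorem orbit_octahedralS4_wallFinite {ω : k} (hω : ω * ω = -1) (h2 : (2 : k) ≠ 0) {r : k}
    (hr : r - 1 ≠ 0) (hr' : r + 1 ≠ 0) :
    MulAction.orbit (octahedralS4 k) (wallFinite r) =
      {wallFinite r, wallFinite (-r), wallFinite ((r + 3) / (r - 1)),
        wallFinite (-((r + 3) / (r - 1))), wallFinite ((r - 3) / (r + 1)),
        wallFinite (-((r - 3) / (r + 1)))} := by
  have F := pgl_octahedralFrame ω h2 hω
  have hτN : pglT ω h2 hω ∈ octahedralS4 k := octahedralS4_eq (k := k) ▸ F.τ_mem_normalizer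
  have hsN : pglS h2 ∈ octahedralS4 k := octahedralS4_eq (k := k) ▸ F.s_mem_normalizer
  obtain ⟨hτ, hτ2, hs, hτs, hτ2s⟩ := pow_smul_wallFinite hω h2 hr hr'
  refine Set.Subset.antisymm ?_ ?_
  · rintro _ ⟨g, rfl⟩
    exact smul_wallFinite_mem hω h2 hr hr' g.2
  · rintro _ (rfl | rfl | rfl | rfl | rfl | rfl)
    · exact MulAction.mem_orbit_self _
    · exact ⟨⟨_, mul_mem (pow_mem hτN 2) hsN⟩, (mul_smul _ _ _).trans hτ2s⟩
    · exact ⟨⟨_, mul_mem hτN hsN⟩, (mul_smul _ _ _).trans hτs⟩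
    · exact ⟨⟨_, hτN⟩, hτ⟩
    · exact ⟨⟨_, pow_mem hτN 2⟩, hτ2⟩
    · exact ⟨⟨_, hsN⟩, hs⟩

/-- The group `S₄` normalizes the stabilizer: the latter either is the four-group, or
`ρ² = -3`, in which case the orbit of `p_ρ` is `{p_ρ, p_{-ρ}}` and both members have the same
stabilizer. -/
theorem smul_smul_eq_of_mem_octahedralS4 {ω : k} (hω : ω * ω = -1) (h2 : (2 : k) ≠ 0) {r : k}
    (hr0 : r ≠ 0) (hr1 : r ^ 2 ≠ 1) (hr9 : r ^ 2 ≠ 9) {x g : PGL2 k}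
    (hx : x • wallFinite r = wallFinite r) (hg : g ∈ octahedralS4 k) :
    x • g • wallFinite r = g • wallFinite r := by
  have hr : r - 1 ≠ 0 := fun e => hr1 (by linear_combination (r + 1) * e)
  have hr' : r + 1 ≠ 0 := fun e => hr1 (by linear_combination (r - 1) * e)
  rcases mem_closure_or_of_smul_eq hω h2 hr0 hr1 hr9 hx with hV | ⟨h3, i, d, hd, rfl⟩
  · rw [octahedralS4_eq] at hg
    have := closure_smul_wallFinite ((Subgroup.mem_normalizer_iff''.mp hg x).mp hV) r
    rwa [mul_smul, mul_smul, inv_smul_eq_iff] at this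
  · have key : ∀ t : k, t - 1 ≠ 0 → t ^ 2 = -3 →
        (pglT ω h2 hω ^ i * d) • wallFinite t = wallFinite t := by
      intro t ht ht3
      have hfix : pglT ω h2 hω ∈ MulAction.stabilizer (PGL2 k) (wallFinite t) :=
        pglT_smul_wallFinite_of_sq_eq hω h2 ht ht3
      rw [mul_smul, closure_smul_wallFinite hd]
      exact pow_mem hfix i
    have e1 : (r + 3) / (r - 1) = -r := by field_simp; linear_combination h3
    have e2 : (r - 3) / (r + 1) = r := by field_simp; linear_combination -h3
    have hmem := smul_wallFinite_mem hω h2 hr hr' hg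
    rw [e1, e2, neg_neg] at hmem
    have : g • wallFinite r = wallFinite r ∨ g • wallFinite r = wallFinite (-r) := by
      simp only [Set.mem_insert_iff, Set.mem_singleton_iff] at hmem
      tauto
    rcases this with h | h <;> rw [h]
    · exact key r hr h3
    · exact key (-r) (fun e => hr' (by linear_combination -e)) (by linear_combination h3)

theorem normalizer_stabilizer_wallFinite {ω : k} (hω : ω * ω = -1) (h2 : (2 : k) ≠ 0) {r : k}
    (hr0 : r ≠ 0) (hr1 : r ^ 2 ≠ 1) (hr9 : r ^ 2 ≠ 9) :
    Subgroup.normalizer (MulAction.stabilizer (PGL2 k) (wallFinite r) : Set (PGL2 k))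
      = octahedralS4 k := by
  refine le_antisymm (fun g hg => ?_) fun g hg => ?_
  · refine mem_octahedralS4_of_smul_eq hω h2 hr0 hr1 hr9 (p := g⁻¹ • wallFinite r) ?_
      (smul_inv_smul g _)
    intro d hd
    have := (Subgroup.mem_normalizer_iff.mp hg d).mp (closure_smul_wallFinite hd r)
    rw [MulAction.mem_stabilizer_iff, mul_smul, mul_smul] at this
    exact eq_inv_smul_iff.mpr this
  · refine Subgroup.mem_normalizer_iff''.mpr fun x => ⟨fun hx => ?_, fun hx => ?_⟩
    · change (g⁻¹ * x * g) • wallFinite r = wallFinite r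
      rw [mul_smul, mul_smul, inv_smul_eq_iff]
      exact smul_smul_eq_of_mem_octahedralS4 hω h2 hr0 hr1 hr9 hx hg
    · have := smul_smul_eq_of_mem_octahedralS4 hω h2 hr0 hr1 hr9 hx (inv_mem hg)
      rw [mul_smul, mul_smul, smul_inv_smul] at this
      exact smul_left_cancel _ this

/-- For the degenerate values of `ρ` the stabilizer is infinite, so they are excluded by
stability. -/
theorem IsStable.exists_eq_coe [Infinite k] {ω : k} (hω : ω * ω = -1) (h2 : (2 : k) ≠ 0)
    {ρ : OnePoint k} (h : (wall ρ).IsStable) :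
    ∃ r : k, ρ = (r : OnePoint k) ∧ r ≠ 0 ∧ r ^ 2 ≠ 1 ∧ r ^ 2 ≠ 9 := by
  rcases ρ with _ | r
  · exact absurd h.1 infinite_stabilizer_wallInfty
  · exact ⟨r, rfl, ne_of_finite_stabilizer hω h2 h.1⟩

end Pencil


theorem mainTheorem7 {k : Type*} [Field k] [IsAlgClosed k] (h2 : (2 : k) ≠ 0) (h3 : (3 : k) ≠ 0) :
    -- the distinguished subgroup `S₄ = N(D₄)` is a symmetric group on 4 letters, with generators
    Nonempty (octahedralS4 k ≃* Equiv.Perm (Fin 4)) ∧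
    (∀ ω : k, IsPrimitiveRoot ω 4 →
      octahedralS4 k = pglClosure {!![ω, -1; ω, 1], !![-1, 1; 1, 1],
        !![1, 0; 0, -1], !![0, -1; 1, 0]}) ∧
    -- the normalizer of the stabilizer, and the orbit under `S₄`
    (∀ ρ : OnePoint k, (Pencil.wall ρ).IsStable →
      Subgroup.normalizer
          (MulAction.stabilizer (PGL2 k) (Pencil.wall ρ) : Set (PGL2 k)) = octahedralS4 k ∧
      ∃ r : k, ρ = (r : OnePoint k) ∧ r - 1 ≠ 0 ∧ r + 1 ≠ 0 ∧
        MulAction.orbit (octahedralS4 k) (Pencil.wall ρ) =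
          {Pencil.wall (r : OnePoint k), Pencil.wall ((-r : k) : OnePoint k),
            Pencil.wall (((r + 3) / (r - 1) : k) : OnePoint k),
            Pencil.wall ((-((r + 3) / (r - 1)) : k) : OnePoint k),
            Pencil.wall (((r - 3) / (r + 1) : k) : OnePoint k),
            Pencil.wall ((-((r - 3) / (r + 1)) : k) : OnePoint k)}) ∧
    -- stable Wall representatives in the same `PGL₂`-orbit are related by `S₄`
    (∀ ρ ρ' : OnePoint k, (Pencil.wall ρ).IsStable → (Pencil.wall ρ').IsStable →
      (Pencil.wall ρ' ∈ MulAction.orbit (PGL2 k) (Pencil.wall ρ) ↔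
        ∃ σ ∈ octahedralS4 k, σ • Pencil.wall ρ = Pencil.wall ρ')) := by
  obtain ⟨ω, hω⟩ : ∃ ω : k, ω * ω = -1 := by
    obtain ⟨ω, hω⟩ := IsAlgClosed.exists_eq_mul_self (-1 : k)
    exact ⟨ω, hω.symm⟩
  have F := pgl_octahedralFrame ω h2 hω
  refine ⟨?_, fun ζ hζ => ?_, fun ρ hρ => ?_, fun ρ ρ' hρ hρ' => ?_⟩
  · rw [Pencil.octahedralS4_eq]
    exact F.nonempty_normalizer_mulEquiv_perm
  · have hζ2 : ζ * ζ = -1 := by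
      have h := hζ.pow_eq_one
      have hne : ζ ^ 2 ≠ 1 := hζ.pow_ne_one_of_pos_of_lt (by norm_num) (by norm_num)
      refine eq_neg_of_add_eq_zero_left
        ((mul_eq_zero.mp ?_).resolve_left (sub_ne_zero.mpr hne))
      linear_combination h
    rw [Pencil.octahedralS4_eq, pglClosure_octahedral_eq ζ h2 hζ2,
      (pgl_octahedralFrame ζ h2 hζ2).normalizer_eq_closure]
  · obtain ⟨r, rfl, hr0, hr1, hr9⟩ := hρ.exists_eq_coe hω h2
    have hr : r - 1 ≠ 0 := fun e => hr1 (by linear_combination (r + 1) * e)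
    have hr' : r + 1 ≠ 0 := fun e => hr1 (by linear_combination (r - 1) * e)
    exact ⟨Pencil.normalizer_stabilizer_wallFinite hω h2 hr0 hr1 hr9, r, rfl, hr, hr',
      Pencil.orbit_octahedralS4_wallFinite hω h2 hr hr'⟩
  · obtain ⟨r, rfl, -⟩ := hρ.exists_eq_coe hω h2
    obtain ⟨r', rfl, hr0, hr1, hr9⟩ := hρ'.exists_eq_coe hω h2
    constructor
    · rintro ⟨g, hg⟩
      exact ⟨g, Pencil.mem_octahedralS4_of_smul_eq hω h2 hr0 hr1 hr9
        (fun d hd => Pencil.closure_smul_wallFinite hd r) hg, hg⟩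
    · rintro ⟨σ, -, hσ⟩
      exact ⟨σ, hσ⟩
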